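/- **Setting.** Let $G$ be a directed graph on a set $\mathcal X$ with a self-loop at every node, and put $N_{\rm out}[x]=\{x' : (x,x')\in G\}$, $N_{\rm in}[x]=\{x' : (x',x)\in G\}$ (both contain $x$), $k_{\rm out}=\sup_x|N_{\rm out}[x]|$, $k_{\rm in}=\sup_x|N_{\rm in}[x]|$. For $f:\mathcal X\to[0,1]$ let $\mathsf{BR}_f(x)=\operatorname{argmax}_{v\in N_{\rm out}[x]}f(v)$. Let $\mathcal H\subseteq\{0,1\}^{\mathcal X}$ be a nonempty class. In each round $t=1,\dots,T$ a deterministic learner, knowing only the previous observations $(v_s,y_s)_{s<t}$, implements a classifier $h_t:\mathcal X\to\{0,1\}$; an agent $(x_t,y_t)\in\mathcal X\times\{0,1\}$ arrives and moves to some $v_t\in\mathsf{BR}_{\tilde h^\gamma_t}(x_t)$, ties being broken arbitrarily, where $$\tilde h^\gamma_t=\frac{\sum_{\tau=0}^{t-2}\gamma^\tau h_{t-1-\tau}}{\sum_{\tau=0}^{t-2}\gamma^\tau}$$ (for $t=1$ the estimate is constant, so $v_1\in N_{\rm out}[x_1]$ is arbitrary); the learner observes $(v_t,y_t)$ and makes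 a mistake if $h_t(v_t)\ne y_t$. The agent sequence is strategic realizable if there is $h^\star\in\mathcal H$ such that, for all $t$, $h^\star=y_t$ on $\mathsf{BR}_{h^\star}(x_t)$. Let $\mathcal M_\gamma(\mathcal A,\mathcal H)$ be the supremum of the number of mistakes of the learner $\mathcal A$ over all $T$, all strategic realizable agent sequences of length $T$ and all tie-breakings. **Theorem.** 1. There is a universal constant $c>0$ such that for every $d\in\mathbb N$, every $\gamma\in(0,1)$ and every integer $N\ge 2$ there exist a graph $G$ with $k_{\rm in}=k_{\rm out}=2$ and a finite class $\mathcal H$ of Littlestone dimension $d$, with $|\mathcal H|\ge N$ if $d\ge1$ and $|\mathcal H|=N$ if $d=1$, such that every deterministic learner $\mathcal A$ satisfies $$\mathcal M_\gamma(\mathcal A,\mathcal H)\ \ge\ c\,\min\{d(1-\gamma)^{-1},\,|\mathcal H|\}.$$ 2. For every $\varepsilon>0$ there is a constant $c>0$, depending only on $\varepsilon$, such that for all $d,k_{\rm in},k_{\rm out}\in\mathbb N$ with $k_{\rm in}\ge2$ and $k_{\rm out}\ge(1+\varepsilon)k_{\rm in}$ there exist a graph $G$ with maximum in-degree $k_{\rm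 in}$ and maximum out-degree $k_{\rm out}$, a class $\mathcal H$ of Littlestone dimension $d$, and $\gamma_0>0$ such that, for every $\gamma\in[0,\gamma_0)$ (where for $\gamma=0$ the agents use one-step memory, $\tilde h_t=h_{t-1}$), every deterministic learner $\mathcal A$ satisfies $$\mathcal M_\gamma(\mathcal A,\mathcal H)\ \ge\ c\,d\,k_{\rm in}\,k_{\rm out}.$$ -/

import Mathlib

open scoped ENNReal

/-- A manipulation graph on the feature space `X`: `Edge x x'` means that an agent with initial
feature vector `x` can manipulate to `x'`.  Every node carries a self-loop. -/
structure ManipulationGraph (X : Type) where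
  Edge : X → X → Prop
  self_loop : ∀ x, Edge x x

namespace ManipulationGraph

/-- Out-neighbourhood `N_out[x]` (it contains `x`, because of the self-loop). -/
def outNbhd {X : Type} (G : ManipulationGraph X) (x : X) : Set X := {x' | G.Edge x x'}

/-- In-neighbourhood `N_in[x]` (it contains `x`, because of the self-loop). -/
def inNbhd {X : Type} (G : ManipulationGraph X) (x : X) : Set X := {x' | G.Edge x' x}

/-- Maximum out-degree `k_out = sup_x |N_out[x]|`. -/
noncomputable def maxOutDegree {X : Type} (G : ManipulationGraph X) : ℕ∞ :=
  ⨆ x, (G.outNbhd x).encard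

/-- Maximum in-degree `k_in = sup_x |N_in[x]|`. -/
noncomputable def maxInDegree {X : Type} (G : ManipulationGraph X) : ℕ∞ :=
  ⨆ x, (G.inNbhd x).encard

/-- Best response set: the reachable nodes with the highest predicted value under the (possibly
fractional) predictor `f`. -/
def bestResponse {X : Type} (G : ManipulationGraph X) (f : X → ℝ) (x : X) : Set X :=
  {v | v ∈ G.outNbhd x ∧ ∀ w ∈ G.outNbhd x, f w ≤ f v}

end ManipulationGraph

/-- A `0`-`1` classifier seen as a real-valued predictor (`true` is the positive label `1`). -/
def classifierValue {X : Type} (h : X → Bool) (x : X) : ℝ := if h x = true then 1 else 0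

/-- The class `H` shatters a complete binary mistake tree of depth `n`: the root carries a point
`x`, and for both labels `b` the hypotheses of `H` with value `b` at `x` shatter the subtree (of
depth one less) below the edge labelled `b`.  Every branch of depth `0` has to be realized. -/
def ShattersTree {X : Type} : ℕ → Set (X → Bool) → Prop
  | 0, H => H.Nonempty
  | n + 1, H => ∃ x : X, ∀ b : Bool, ShattersTree n {h ∈ H | h x = b}

/-- Littlestone dimension: the supremum of the depths of shattered mistake trees. -/
noncomputable def littlestoneDim {X : Type} (H : Set (X → Bool)) : ℕ∞ :=
  ⨆ (n : ℕ) (_ : ShattersTree n H), (n : ℕ∞)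

/-- A deterministic learner: it maps the list of the observations (post-manipulation feature
vector, true label) of all previous rounds to the classifier of the current round. -/
abbrev DetLearner (X : Type) : Type := List (X × Bool) → X → Bool

/-- The classifier implemented in round `t` (rounds are numbered `0, 1, 2, …`) when the observed
post-manipulation vectors are `v` and the true labels are `y`. -/
def DetLearner.classifier {X : Type} (A : DetLearner X) (v : ℕ → X) (y : ℕ → Bool) (t : ℕ) :
    X → Bool :=
  A ((List.range t).map fun s => (v s, y s))

/-- The agents' estimate in round `t`: the `γ`-discounted average of the classifiers
`h 0, …, h (t - 1)` of the `t` previous rounds, the most recent one having weight `γ ^ 0 = 1`.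
In round `0` there is no history and the estimate is constant (every reachable node is then a best
response); for `γ = 0` the estimate is the classifier of the previous round. -/
noncomputable def weightedEstimate {X : Type} (γ : ℝ) (h : ℕ → X → Bool) (t : ℕ) (x : X) : ℝ :=
  (∑ τ ∈ Finset.range t, γ ^ τ * classifierValue (h (t - 1 - τ)) x) /
    ∑ τ ∈ Finset.range t, γ ^ τ

/-- The agent sequence `(x t, y t)`, `t < T`, is strategic realizable by `H`: some hypothesis of
`H` gives every agent its true label when the agent best responds to that hypothesis. -/
def StrategicRealizable {X : Type} (G : ManipulationGraph X) (H : Set (X → Bool)) (T : ℕ)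
    (x : ℕ → X) (y : ℕ → Bool) : Prop :=
  ∃ h ∈ H, ∀ t < T, ∀ w ∈ G.bestResponse (classifierValue h) (x t), h w = y t

/-- In each of the rounds `t < T` against the learner `A`, the agent moves from `x t` to some best
response `v t` to the `γ`-weighted average of the previously implemented classifiers. -/
def WeightedResponses {X : Type} (G : ManipulationGraph X) (γ : ℝ) (A : DetLearner X) (T : ℕ)
    (x : ℕ → X) (y : ℕ → Bool) (v : ℕ → X) : Prop :=
  ∀ t < T, v t ∈ G.bestResponse (weightedEstimate γ (A.classifier v y) t) (x t)

/-- Number of mistakes `h_t (v_t) ≠ y_t` of the learner during the first `T` rounds. -/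
def mistakes {X : Type} (A : DetLearner X) (T : ℕ) (y : ℕ → Bool) (v : ℕ → X) : ℕ :=
  ((Finset.range T).filter fun t => A.classifier v y t (v t) ≠ y t).card

/-- The mistake bound of the learner `A` against `γ`-weighted agents: the supremum of the number
of mistakes over all finite agent sequences that are strategic realizable by `H` and over all ways
of breaking ties among the best responses. -/
noncomputable def weightedMistakeBound {X : Type} (G : ManipulationGraph X) (H : Set (X → Bool))
    (γ : ℝ) (A : DetLearner X) : ℕ∞ :=
  ⨆ (T : ℕ) (x : ℕ → X) (y : ℕ → Bool) (v : ℕ → X)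
    (_ : StrategicRealizable G H T x y ∧ WeightedResponses G γ A T x y v),
    (mistakes A T y v : ℕ∞)

/-!
The agent behind an observation is hidden from the learner, so the adversary only has to fix the
observations; for each hypothesis the agents may be chosen in hindsight (`Explains`, `Forces`).
Both parts use a base class in which, at every node, all hypotheses but at most one agree, and then
take `d` independent copies of it next to a graph that attains the prescribed degrees.  The
Littlestone dimension of the product is `d` (`littlestoneDim_copies`), and a base game that costs
`M` mistakes from any history on makes the product cost `d * M` mistakes
(`card_mul_le_weightedMistakeBound`).

**Long memory.**  The base graph consists of paths `source → middle → sink`.  The hypothesis with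
target `i` is positive at the sink of path `i` and at the middle nodes of all other paths.  As long
as a path may or may not be the target, predicting anything but a positive middle node and a
negative sink on it costs a mistake that refutes only this target
(`exists_forces_of_deviation`).  So either the hypotheses are used up one by one, or the learner
keeps this pattern so long that the memory of some possible target `i` is about `1 / (1 - γ)` at the
middle node and almost `0` at the sink.  Then `i` becomes the target.  While the memory still
favours the middle node, which takes of order `1 / (1 - γ)` rounds to change, a negative middle node is
punished by positive agents that stay there, and a positive one by negative agents coming from the
source, unless the memory favours the source over the middle node.  The learner can maintain the
latter in at most about half of the rounds (`exists_forces_of_target`).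

**Short memory.**  The base graph consists of points and lines of an affine plane, with each point
replaced by a cluster; a line can move to its points and to the lines parallel to it.  The
hypotheses are the single points.  Wherever the memory is maximal, that node is visible from some
line through each given point, since two points lie on a common line and parallel lines cover the
plane.  Hence the adversary can always show this node with the label opposite to the prediction,
and this refutes at most one point (`exists_forces_design_step`).  This works for every
discount factor and costs about as many mistakes as there are points, which is of order
`k_in * k_out` when the order of the plane is a prime between `k_in / 8` and `k_in / 4`; for
small `k_in` a single line suffices.
-/

/-! ### Histories of the game -/

/-- The unnormalised memory of the agents: the `γ`-discounted sum of the classifiers implemented so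
far.  Histories are lists of observations with the newest observation at the head, whereas a learner
reads its observations in chronological order. -/
noncomputable def memory {X : Type} (γ : ℝ) (A : DetLearner X) : List (X × Bool) → X → ℝ
  | [], _ => 0
  | _ :: l, x => γ * memory γ A l x + classifierValue (A l.reverse) x

/-- The hypothesis `h` explains a history if every observation in it comes from some agent that best
responds to the memory and whose label is the one that `h` prescribes.  The agent is hidden from
the learner, so it may be chosen separately for each `h`, in hindsight. -/
def Explains {X : Type} (G : ManipulationGraph X) (γ : ℝ) (A : DetLearner X) (h : X → Bool) :
    List (X × Bool) → Prop
  | [] => True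
  | e :: l => Explains G γ A h l ∧ ∃ x, e.1 ∈ G.bestResponse (memory γ A l) x ∧
      ∀ w ∈ G.bestResponse (classifierValue h) x, h w = e.2

/-- Number of mistakes of the learner along a history. -/
def missCount {X : Type} (A : DetLearner X) : List (X × Bool) → ℕ
  | [] => 0
  | e :: l => missCount A l + if A l.reverse e.1 ≠ e.2 then 1 else 0

theorem classifierValue_nonneg {X : Type} (h : X → Bool) (x : X) : 0 ≤ classifierValue h x := by
  unfold classifierValue; split_ifs <;> norm_num

theorem classifierValue_le_one {X : Type} (h : X → Bool) (x : X) : classifierValue h x ≤ 1 := by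
  unfold classifierValue; split_ifs <;> norm_num

theorem classifierValue_of_true {X : Type} {h : X → Bool} {x : X} (hx : h x = true) :
    classifierValue h x = 1 := by simp [classifierValue, hx]

theorem classifierValue_of_false {X : Type} {h : X → Bool} {x : X} (hx : h x = false) :
    classifierValue h x = 0 := by simp [classifierValue, hx]

theorem memory_nonneg {X : Type} {γ : ℝ} (hγ : 0 ≤ γ) (A : DetLearner X) (l : List (X × Bool))
    (x : X) : 0 ≤ memory γ A l x := by
  induction l with
  | nil => simp [memory]
  | cons e l ih =>
    have := classifierValue_nonneg (A l.reverse) x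
    simp only [memory]; positivity

theorem memory_le {X : Type} {γ : ℝ} (hγ : 0 ≤ γ) (hγ1 : γ < 1) (A : DetLearner X)
    (l : List (X × Bool)) (x : X) : memory γ A l x ≤ (1 - γ)⁻¹ := by
  have h1 : (0 : ℝ) < 1 - γ := by linarith
  have hS : γ * (1 - γ)⁻¹ + 1 = (1 - γ)⁻¹ := by field_simp; ring
  induction l with
  | nil => simp only [memory]; positivity
  | cons e l ih =>
    have := classifierValue_le_one (A l.reverse) x
    simp only [memory]
    nlinarith [mul_le_mul_of_nonneg_left ih hγ]

/-- Applied to a sequence of observations, `memory` is the numerator of `weightedEstimate`. -/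
theorem memory_range {X : Type} (γ : ℝ) (A : DetLearner X) (v : ℕ → X) (y : ℕ → Bool) (t : ℕ)
    (x : X) :
    memory γ A ((List.range t).map fun s => (v s, y s)).reverse x =
      ∑ τ ∈ Finset.range t, γ ^ τ * classifierValue (A.classifier v y (t - 1 - τ)) x := by
  induction t with
  | zero => simp [memory]
  | succ t ih =>
    rw [List.range_succ, List.map_append, List.reverse_append, Finset.sum_range_succ']
    simp only [List.map_cons, List.map_nil, List.reverse_cons, List.reverse_nil, List.nil_append,
      List.singleton_append, memory, List.reverse_reverse, ih, Finset.mul_sum]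
    congr 1
    · refine Finset.sum_congr rfl fun τ _ => ?_
      rw [show t + 1 - 1 - (τ + 1) = t - 1 - τ by omega]
      ring
    · simp [DetLearner.classifier]

/-- The agents' best responses to the normalised and to the unnormalised memory agree, also in the
first round, where both are zero. -/
theorem bestResponse_weightedEstimate {X : Type} (G : ManipulationGraph X) {γ : ℝ} (hγ : 0 ≤ γ)
    (A : DetLearner X) (v : ℕ → X) (y : ℕ → Bool) (t : ℕ) (x : X) :
    G.bestResponse (weightedEstimate γ (A.classifier v y) t) x =
      G.bestResponse (memory γ A ((List.range t).map fun s => (v s, y s)).reverse) x := by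
  have key : ∀ a b, weightedEstimate γ (A.classifier v y) t a ≤
      weightedEstimate γ (A.classifier v y) t b ↔
      memory γ A ((List.range t).map fun s => (v s, y s)).reverse a ≤
      memory γ A ((List.range t).map fun s => (v s, y s)).reverse b := by
    intro a b
    simp only [weightedEstimate, memory_range]
    rcases t with _ | t
    · simp
    · have : 0 < ∑ τ ∈ Finset.range (t + 1), γ ^ τ := by
        rw [Finset.sum_range_succ']
        have : 0 ≤ ∑ τ ∈ Finset.range t, γ ^ (τ + 1) := Finset.sum_nonneg fun _ _ => by positivity
        simp only [pow_zero]; linarith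
      exact div_le_div_iff_of_pos_right this
  ext w
  simp only [ManipulationGraph.bestResponse, Set.mem_ofPred_eq, key]

theorem missCount_range {X : Type} (A : DetLearner X) (v : ℕ → X) (y : ℕ → Bool) (t : ℕ) :
    missCount A ((List.range t).map fun s => (v s, y s)).reverse = mistakes A t y v := by
  induction t with
  | zero => simp [missCount, mistakes]
  | succ t ih =>
    rw [List.range_succ, List.map_append, List.reverse_append]
    simp only [List.map_cons, List.map_nil, List.reverse_cons, List.reverse_nil, List.nil_append,
      List.singleton_append, missCount, List.reverse_reverse, ih]
    change _ + (if A.classifier v y t (v t) ≠ y t then 1 else 0) = _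
    rw [mistakes, mistakes, Finset.range_add_one, Finset.filter_insert]
    split_ifs
    · rw [Finset.card_insert_of_notMem (by simp)]
    · rfl

theorem Explains.exists_agent {X : Type} {G : ManipulationGraph X} {γ : ℝ} {A : DetLearner X}
    {h : X → Bool} {v : ℕ → X} {y : ℕ → Bool} {T : ℕ}
    (hl : Explains G γ A h ((List.range T).map fun s => (v s, y s)).reverse) :
    ∀ t < T, ∃ x, v t ∈ G.bestResponse
      (memory γ A ((List.range t).map fun s => (v s, y s)).reverse) x ∧
      ∀ w ∈ G.bestResponse (classifierValue h) x, h w = y t := by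
  induction T with
  | zero => simp
  | succ T ih =>
    rw [List.range_succ, List.map_append, List.reverse_append] at hl
    intro t ht
    rcases Nat.lt_succ_iff_lt_or_eq.1 ht with ht | rfl
    · exact ih hl.1 t ht
    · exact hl.2

/-- A history explained by a hypothesis of the class is a legal play of the game. -/
theorem missCount_le_weightedMistakeBound {X : Type} {G : ManipulationGraph X} {γ : ℝ}
    (hγ : 0 ≤ γ) {A : DetLearner X} {H : Set (X → Bool)} {h : X → Bool} (hH : h ∈ H)
    {l : List (X × Bool)} (hl : Explains G γ A h l) :
    (missCount A l : ℕ∞) ≤ weightedMistakeBound G H γ A := by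
  rcases l with _ | ⟨e, l⟩
  · simp [missCount]
  obtain ⟨o, ho⟩ : ∃ o : ℕ → X × Bool,
      ((List.range (e :: l).reverse.length).map o) = (e :: l).reverse := by
    refine ⟨fun t => (e :: l).reverse.getD t e, List.ext_getElem (by simp) fun n h1 h2 => ?_⟩
    rw [List.getElem_map, List.getElem_range, List.getD_eq_getElem _ _ h2]
  generalize (e :: l).reverse.length = T at ho
  have hl' : e :: l = ((List.range T).map fun s => ((o s).1, (o s).2)).reverse := by
    rw [← List.reverse_reverse (e :: l), ← ho]
  rw [hl'] at hl ⊢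
  have : Nonempty X := ⟨e.1⟩
  choose! x hx hx' using hl.exists_agent
  rw [missCount_range A (fun s => (o s).1) (fun s => (o s).2)]
  unfold weightedMistakeBound
  refine le_iSup_of_le T <| le_iSup_of_le x <| le_iSup_of_le (fun s => (o s).2) <|
    le_iSup_of_le (fun s => (o s).1) <| le_iSup_of_le ⟨⟨h, hH, hx'⟩, fun t ht => ?_⟩ le_rfl
  rw [bestResponse_weightedEstimate G hγ]
  exact hx t ht

theorem ofReal_le_toENNReal {x : ℝ} {n : ℕ} {b : ℕ∞} (hx : x ≤ n) (hn : (n : ℕ∞) ≤ b) :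
    ENNReal.ofReal x ≤ (b : ℝ≥0∞) := by
  refine (ENNReal.ofReal_le_ofReal hx).trans ?_
  rw [ENNReal.ofReal_natCast, ← ENat.toENNReal_coe]
  exact ENat.toENNReal_le.2 hn

/-- From the history `l` the adversary can pass to the history `l'`, forcing `n` mistakes on the
way, without refuting any hypothesis in `Hs`. -/
def Forces {X : Type} (G : ManipulationGraph X) (γ : ℝ) (A : DetLearner X) (Hs : Set (X → Bool))
    (n : ℕ) (l l' : List (X × Bool)) : Prop :=
  (∀ h ∈ Hs, Explains G γ A h l → Explains G γ A h l') ∧ missCount A l + n ≤ missCount A l'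

theorem Forces.refl {X : Type} {G : ManipulationGraph X} {γ : ℝ} {A : DetLearner X}
    {Hs : Set (X → Bool)} (l : List (X × Bool)) : Forces G γ A Hs 0 l l :=
  ⟨fun _ _ h => h, le_rfl⟩

theorem Forces.trans {X : Type} {G : ManipulationGraph X} {γ : ℝ} {A : DetLearner X}
    {Hs : Set (X → Bool)} {m n : ℕ} {l l' l'' : List (X × Bool)} (h₁ : Forces G γ A Hs m l l')
    (h₂ : Forces G γ A Hs n l' l'') : Forces G γ A Hs (m + n) l l'' :=
  ⟨fun h hh hl => h₂.1 h hh (h₁.1 h hh hl), by have := h₁.2; have := h₂.2; omega⟩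

theorem Forces.mono {X : Type} {G : ManipulationGraph X} {γ : ℝ} {A : DetLearner X}
    {Hs Hs' : Set (X → Bool)} {m n : ℕ} {l l' : List (X × Bool)} (h : Forces G γ A Hs m l l')
    (hs : Hs' ⊆ Hs) (hn : n ≤ m) : Forces G γ A Hs' n l l' :=
  ⟨fun g hg => h.1 g (hs hg), by have := h.2; omega⟩

theorem Forces.step {X : Type} {G : ManipulationGraph X} {γ : ℝ} {A : DetLearner X}
    {Hs : Set (X → Bool)} {l : List (X × Bool)} {v : X} {y : Bool}
    (h : ∀ h ∈ Hs, ∃ x, v ∈ G.bestResponse (memory γ A l) x ∧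
      ∀ w ∈ G.bestResponse (classifierValue h) x, h w = y) :
    Forces G γ A Hs (if A l.reverse v ≠ y then 1 else 0) l ((v, y) :: l) :=
  ⟨fun g hg hl => ⟨hl, h g hg⟩, le_rfl⟩

namespace ManipulationGraph

theorem label_eq_true {X : Type} {G : ManipulationGraph X} {h : X → Bool} {x w₀ : X}
    (hw₀ : w₀ ∈ G.outNbhd x) (h₀ : h w₀ = true) :
    ∀ w ∈ G.bestResponse (classifierValue h) x, h w = true := by
  intro w hw
  by_contra hne
  have := hw.2 w₀ hw₀
  rw [classifierValue_of_true h₀, classifierValue_of_false (by simpa using hne)] at this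
  linarith

theorem label_eq_false {X : Type} {G : ManipulationGraph X} {h : X → Bool} {x : X}
    (hx : ∀ w ∈ G.outNbhd x, h w = false) :
    ∀ w ∈ G.bestResponse (classifierValue h) x, h w = false :=
  fun w hw => hx w hw.1

end ManipulationGraph

/-! ### Independent copies of a base game -/

/-- Copies of the graph `B`, one for each element of `D`, next to the graph `Z`. -/
def ManipulationGraph.copies {Y Z : Type} (D : Type) (B : ManipulationGraph Y)
    (P : ManipulationGraph Z) : ManipulationGraph ((D × Y) ⊕ Z) where
  Edge
    | .inl p, .inl q => p.1 = q.1 ∧ B.Edge p.2 q.2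
    | .inr z, .inr z' => P.Edge z z'
    | _, _ => False
  self_loop
    | .inl p => ⟨rfl, B.self_loop p.2⟩
    | .inr z => P.self_loop z

/-- The hypothesis that follows the base hypothesis `g (f k)` on the copy with index `k`, and is
negative outside the copies. -/
def copiesHyp {D Y Z ι : Type} (g : ι → Y → Bool) (f : D → ι) : (D × Y) ⊕ Z → Bool
  | .inl p => g (f p.1) p.2
  | .inr _ => false

namespace ManipulationGraph

variable {D Y Z : Type} (B : ManipulationGraph Y) (P : ManipulationGraph Z)

theorem outNbhd_copies_inl (k : D) (y : Y) :
    (B.copies D P).outNbhd (.inl (k, y)) = (fun y' => Sum.inl (k, y')) '' B.outNbhd y := by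
  ext (⟨k', y'⟩ | z)
  · constructor
    · rintro ⟨rfl, h⟩
      exact ⟨y', h, rfl⟩
    · rintro ⟨y'', h, h'⟩
      obtain ⟨rfl, rfl⟩ := Prod.mk.inj (Sum.inl_injective h')
      exact ⟨rfl, h⟩
  · exact ⟨False.elim, fun ⟨_, _, h⟩ => by cases h⟩

theorem outNbhd_copies_inr (z : Z) :
    (B.copies D P).outNbhd (.inr z) = Sum.inr '' P.outNbhd z := by
  ext (⟨k', y'⟩ | z')
  · exact ⟨False.elim, fun ⟨_, _, h⟩ => by cases h⟩
  · constructor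
    · exact fun h => ⟨z', h, rfl⟩
    · rintro ⟨y'', h, h'⟩
      obtain rfl := Sum.inr_injective h'
      exact h

theorem inNbhd_copies_inl (k : D) (y : Y) :
    (B.copies D P).inNbhd (.inl (k, y)) = (fun y' => Sum.inl (k, y')) '' B.inNbhd y := by
  ext (⟨k', y'⟩ | z)
  · constructor
    · rintro ⟨rfl, h⟩
      exact ⟨y', h, rfl⟩
    · rintro ⟨y'', h, h'⟩
      obtain ⟨rfl, rfl⟩ := Prod.mk.inj (Sum.inl_injective h')
      exact ⟨rfl, h⟩
  · exact ⟨False.elim, fun ⟨_, _, h⟩ => by cases h⟩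

theorem inNbhd_copies_inr (z : Z) :
    (B.copies D P).inNbhd (.inr z) = Sum.inr '' P.inNbhd z := by
  ext (⟨k', y'⟩ | z')
  · exact ⟨False.elim, fun ⟨_, _, h⟩ => by cases h⟩
  · constructor
    · exact fun h => ⟨z', h, rfl⟩
    · rintro ⟨y'', h, h'⟩
      obtain rfl := Sum.inr_injective h'
      exact h

theorem inl_injective_right (k : D) :
    Function.Injective (fun y : Y => (Sum.inl (k, y) : (D × Y) ⊕ Z)) :=
  fun _ _ h => (Prod.mk.inj (Sum.inl_injective h)).2

variable {B P}

theorem maxOutDegree_copies (h : ∀ y, (B.outNbhd y).encard ≤ P.maxOutDegree) :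
    (B.copies D P).maxOutDegree = P.maxOutDegree := by
  refine le_antisymm (iSup_le ?_) (iSup_le fun z => le_iSup_of_le (.inr z) ?_)
  · rintro (⟨k, y⟩ | z)
    · rw [outNbhd_copies_inl, (inl_injective_right k).encard_image]
      exact h y
    · rw [outNbhd_copies_inr, Sum.inr_injective.encard_image]
      exact le_iSup (fun z => (P.outNbhd z).encard) z
  · rw [outNbhd_copies_inr, Sum.inr_injective.encard_image]

theorem maxInDegree_copies (h : ∀ y, (B.inNbhd y).encard ≤ P.maxInDegree) :
    (B.copies D P).maxInDegree = P.maxInDegree := by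
  refine le_antisymm (iSup_le ?_) (iSup_le fun z => le_iSup_of_le (.inr z) ?_)
  · rintro (⟨k, y⟩ | z)
    · rw [inNbhd_copies_inl, (inl_injective_right k).encard_image]
      exact h y
    · rw [inNbhd_copies_inr, Sum.inr_injective.encard_image]
      exact le_iSup (fun z => (P.inNbhd z).encard) z
  · rw [inNbhd_copies_inr, Sum.inr_injective.encard_image]

theorem inl_mem_bestResponse_copies {F : (D × Y) ⊕ Z → ℝ} {k : D} {y y' : Y} :
    Sum.inl (k, y') ∈ (B.copies D P).bestResponse F (.inl (k, y)) ↔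
      y' ∈ B.bestResponse (fun z => F (.inl (k, z))) y := by
  simp only [bestResponse, Set.mem_ofPred_eq, outNbhd_copies_inl, Set.forall_mem_image,
    (inl_injective_right k).mem_set_image]

theorem label_copies {ι : Type} {g : ι → Y → Bool} {f : D → ι} {k : D} {y : Y} {b : Bool}
    (h : ∀ w ∈ B.bestResponse (classifierValue (g (f k))) y, g (f k) w = b) :
    ∀ w ∈ (B.copies D P).bestResponse (classifierValue (copiesHyp g f)) (.inl (k, y)),
      copiesHyp g f w = b := by
  intro w hw
  have hw' := hw.1
  rw [outNbhd_copies_inl] at hw'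
  obtain ⟨y', -, rfl⟩ := hw'
  exact h y' (inl_mem_bestResponse_copies.1 hw)

end ManipulationGraph

/-- One round of the game inside the copy with index `k`. -/
theorem Forces.copies_step {D Y Z ι : Type} {B : ManipulationGraph Y} {P : ManipulationGraph Z}
    {γ : ℝ} {A : DetLearner ((D × Y) ⊕ Z)} {g : ι → Y → Bool} {k : D} {S : Set ι}
    {l : List (((D × Y) ⊕ Z) × Bool)} {v : Y} {b : Bool}
    (h : ∀ i ∈ S, ∃ y, v ∈ B.bestResponse (fun z => memory γ A l (.inl (k, z))) y ∧
      ∀ w ∈ B.bestResponse (classifierValue (g i)) y, g i w = b) :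
    Forces (B.copies D P) γ A (copiesHyp g '' {f | f k ∈ S})
      (if A l.reverse (.inl (k, v)) ≠ b then 1 else 0) l ((.inl (k, v), b) :: l) := by
  refine Forces.step ?_
  rintro _ ⟨f, hf, rfl⟩
  obtain ⟨y, hy, hy'⟩ := h _ hf
  exact ⟨.inl (k, y), ManipulationGraph.inl_mem_bestResponse_copies.2 hy,
    ManipulationGraph.label_copies hy'⟩

/-- A round that forces a mistake inside the copy with index `k`: the label is the opposite of the
prediction. -/
theorem Forces.copies_mistake {D Y Z ι : Type} {B : ManipulationGraph Y} {P : ManipulationGraph Z}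
    {γ : ℝ} {A : DetLearner ((D × Y) ⊕ Z)} {g : ι → Y → Bool} {k : D} {S : Set ι}
    {l : List (((D × Y) ⊕ Z) × Bool)} {v : Y} {b : Bool} (hb : A l.reverse (.inl (k, v)) = !b)
    (h : ∀ i ∈ S, ∃ y, v ∈ B.bestResponse (fun z => memory γ A l (.inl (k, z))) y ∧
      ∀ w ∈ B.bestResponse (classifierValue (g i)) y, g i w = b) :
    Forces (B.copies D P) γ A (copiesHyp g '' {f | f k ∈ S}) 1 l ((.inl (k, v), b) :: l) :=
  (Forces.copies_step h).mono subset_rfl (by rw [hb]; simp)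

/-- If every copy can be made to cost `M` mistakes from any history on, then the whole class costs
`M` mistakes per copy: the copies are played one after the other, and the surviving base hypotheses
are put together. -/
theorem card_mul_le_weightedMistakeBound {D Y Z ι : Type} [Fintype D] [Nonempty ι]
    {B : ManipulationGraph Y} {P : ManipulationGraph Z} {γ : ℝ} (hγ : 0 ≤ γ)
    {A : DetLearner ((D × Y) ⊕ Z)} {g : ι → Y → Bool} {M : ℕ}
    (h : ∀ k l, ∃ i l', Forces (B.copies D P) γ A (copiesHyp g '' {f | f k = i}) M l l') :
    ((Fintype.card D * M : ℕ) : ℕ∞) ≤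
      weightedMistakeBound (B.copies D P) (Set.range (copiesHyp g)) γ A := by
  classical
  have key : ∀ s : Finset D, ∃ (φ : D → ι) (l : List (((D × Y) ⊕ Z) × Bool)),
      Forces (B.copies D P) γ A (copiesHyp g '' {f | ∀ k ∈ s, f k = φ k}) (s.card * M) [] l := by
    intro s
    induction s using Finset.induction with
    | empty =>
      exact ⟨fun _ => Classical.arbitrary ι, [], (Forces.refl []).mono subset_rfl (by simp)⟩
    | insert k s hk ih =>
      obtain ⟨φ, l, hl⟩ := ih
      obtain ⟨i, l', hl'⟩ := h k l
      refine ⟨Function.update φ k i, l', ((hl.mono ?_ le_rfl).trans (hl'.mono ?_ le_rfl)).mono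
        subset_rfl ?_⟩
      · refine Set.image_mono fun f hf k' hk' => ?_
        rw [hf k' (Finset.mem_insert_of_mem hk'),
          Function.update_of_ne (by rintro rfl; exact hk hk')]
      · refine Set.image_mono fun f hf => ?_
        have := hf k (Finset.mem_insert_self k s)
        rwa [Function.update_self] at this
      · rw [Finset.card_insert_of_notMem hk, Nat.succ_mul]
  obtain ⟨φ, l, hl, hM⟩ := key Finset.univ
  refine le_trans ?_ (missCount_le_weightedMistakeBound hγ (Set.mem_range_self φ)
    (hl _ ⟨φ, fun _ _ => rfl, rfl⟩ trivial))
  rw [Finset.card_univ] at hM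
  exact_mod_cast le_of_add_le_right hM

/-! ### Littlestone dimension of a product class -/

theorem ShattersTree.nonempty {X : Type} {n : ℕ} {H : Set (X → Bool)} (h : ShattersTree n H) :
    H.Nonempty := by
  induction n generalizing H with
  | zero => exact h
  | succ n ih =>
    obtain ⟨x, hx⟩ := h
    exact (ih (hx true)).mono fun _ h => h.1

/-- If at each point all base hypotheses but at most one agree, then each level of a shattered tree
fixes the base hypothesis on one more copy. -/
theorem ShattersTree.add_card_le {D Y Z ι : Type} [Fintype D] [DecidableEq D] {g : ι → Y → Bool}
    (hg : ∀ y, ∃ i₀ b, ∀ i, i ≠ i₀ → g i y = b) {n : ℕ} {K : Set ((D × Y) ⊕ Z → Bool)}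
    (hK : ShattersTree n K) (S : Finset D) (φ : D → ι)
    (h : K ⊆ copiesHyp g '' {f | ∀ k ∈ S, f k = φ k}) : n + S.card ≤ Fintype.card D := by
  induction n generalizing K S φ with
  | zero => simpa using S.card_le_univ
  | succ n ih =>
    obtain ⟨x, hx⟩ := hK
    rcases x with ⟨k, y⟩ | z
    · by_cases hk : k ∈ S
      · -- A point in a copy that is already fixed cannot be split.
        exfalso
        obtain ⟨q, hq, hq'⟩ := (hx true).nonempty
        obtain ⟨q₂, hq₂, hq₂'⟩ := (hx false).nonempty
        obtain ⟨f, hf, rfl⟩ := h hq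
        obtain ⟨f₂, hf₂, rfl⟩ := h hq₂
        simp only [copiesHyp, hf k hk] at hq'
        simp only [copiesHyp, hf₂ k hk] at hq₂'
        rw [hq'] at hq₂'
        cases hq₂'
      · obtain ⟨i₀, b, hb⟩ := hg y
        have := ih (hx (!b)) (insert k S) (Function.update φ k i₀) ?_
        · rw [Finset.card_insert_of_notMem hk] at this
          omega
        · rintro q ⟨hq, hq'⟩
          obtain ⟨f, hf, rfl⟩ := h hq
          refine ⟨f, fun k' hk' => ?_, rfl⟩
          rcases Finset.mem_insert.1 hk' with rfl | hkS
          · rw [Function.update_self]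
            by_contra hne
            simp only [copiesHyp, hb _ hne] at hq'
            cases b <;> cases hq'
          · rw [Function.update_of_ne (by rintro rfl; exact hk hkS)]
            exact hf k' hkS
    · obtain ⟨q, hq, hq'⟩ := (hx true).nonempty
      obtain ⟨f, -, rfl⟩ := h hq
      cases hq'

theorem shattersTree_of_copies {D Y Z ι : Type} [DecidableEq D] {g : ι → Y → Bool} {y₀ : Y}
    {i : Bool → ι} (hi : ∀ b, g (i b) y₀ = b) (S : Finset D) (φ : D → ι)
    (K : Set ((D × Y) ⊕ Z → Bool)) (h : copiesHyp g '' {f | ∀ k ∉ S, f k = φ k} ⊆ K) :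
    ShattersTree S.card K := by
  induction S using Finset.induction generalizing φ K with
  | empty => exact ⟨copiesHyp g φ, h ⟨φ, fun _ _ => rfl, rfl⟩⟩
  | insert k S hk ih =>
    rw [Finset.card_insert_of_notMem hk]
    refine ⟨.inl (k, y₀), fun b => ih (Function.update φ k (i b)) _ ?_⟩
    rintro _ ⟨f, hf, rfl⟩
    have hfk : f k = i b := by rw [hf k hk, Function.update_self]
    refine ⟨h ⟨f, fun k' hk' => ?_, rfl⟩, by simp only [copiesHyp, hfk, hi]⟩
    rw [Finset.mem_insert, not_or] at hk'
    rw [hf k' hk'.2, Function.update_of_ne hk'.1]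

theorem littlestoneDim_copies {D Y Z ι : Type} [Fintype D] {g : ι → Y → Bool}
    (hg : ∀ y, ∃ i₀ b, ∀ i, i ≠ i₀ → g i y = b) {y₀ : Y} {i : Bool → ι}
    (hi : ∀ b, g (i b) y₀ = b) :
    littlestoneDim (Set.range (copiesHyp g : (D → ι) → (D × Y) ⊕ Z → Bool)) = Fintype.card D := by
  classical
  refine le_antisymm (iSup₂_le fun n hn => ?_) ?_
  · have := hn.add_card_le hg ∅ (fun _ => i true) (by simp)
    exact_mod_cast (by simpa using this : n ≤ Fintype.card D)
  · exact le_iSup₂_of_le (Fintype.card D)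
      (shattersTree_of_copies hi Finset.univ (fun _ => i true) _ (Set.image_subset_range _ _))
      le_rfl

/-! ### A graph with prescribed degrees -/

/-- The graph on `ℕ` in which node `0` can move to all nodes below `m`, and all nodes below `n` can
move to node `0`. -/
def padGraph (n m : ℕ) : ManipulationGraph ℕ where
  Edge i j := i = j ∨ (i = 0 ∧ j < m) ∨ (j = 0 ∧ i < n)
  self_loop _ := .inl rfl

theorem encard_Iio_nat (m : ℕ) : ({j | j < m} : Set ℕ).encard = m := by
  have : ({j | j < m} : Set ℕ) = (Finset.range m : Set ℕ) := by ext; simp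
  rw [this, Set.encard_coe_eq_coe_finsetCard, Finset.card_range]

theorem encard_pair_le_two {α : Type} (a b : α) : ({a, b} : Set α).encard ≤ 2 :=
  (Set.encard_insert_le _ _).trans (by rw [Set.encard_singleton]; norm_num)

theorem maxOutDegree_padGraph {n m : ℕ} (hm : 2 ≤ m) : (padGraph n m).maxOutDegree = m := by
  refine le_antisymm (iSup_le fun i => ?_) (le_iSup_of_le 0 ?_)
  · rcases eq_or_ne i 0 with rfl | hi
    · rw [← encard_Iio_nat m]
      refine Set.encard_le_encard ?_
      rintro j (rfl | h | h)
      · exact (by omega : 0 < m)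
      · exact h.2
      · exact (by omega : j < m)
    · have h : (padGraph n m).outNbhd i ⊆ {i, 0} := by
        rintro j (rfl | h | h)
        · simp
        · exact absurd h.1 hi
        · simp [h.1]
      exact (Set.encard_le_encard h).trans ((encard_pair_le_two _ _).trans (by exact_mod_cast hm))
  · rw [← encard_Iio_nat m]
    exact Set.encard_le_encard fun j hj => .inr (.inl ⟨rfl, hj⟩)

theorem maxInDegree_padGraph {n m : ℕ} (hn : 2 ≤ n) : (padGraph n m).maxInDegree = n := by
  refine le_antisymm (iSup_le fun i => ?_) (le_iSup_of_le 0 ?_)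
  · rcases eq_or_ne i 0 with rfl | hi
    · rw [← encard_Iio_nat n]
      refine Set.encard_le_encard ?_
      rintro j (rfl | h | h)
      · exact (by omega : 0 < n)
      · exact (by omega : j < n)
      · exact h.2
    · have h : (padGraph n m).inNbhd i ⊆ {i, 0} := by
        rintro j (rfl | h | h)
        · simp
        · simp [h.1]
        · exact absurd h.1 hi
      exact (Set.encard_le_encard h).trans ((encard_pair_le_two _ _).trans (by exact_mod_cast hn))
  · rw [← encard_Iio_nat n]
    exact Set.encard_le_encard fun j hj => .inr (.inr ⟨rfl, hj⟩)

/-! ### Paths of length two: the game against long memory -/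

/-- The three nodes of a directed path. -/
inductive PathNode
  | source
  | middle
  | sink

open PathNode

/-- The edges of the path `source → middle → sink` and the self-loops. -/
inductive PathNode.Edge : PathNode → PathNode → Prop
  | refl (s : PathNode) : PathNode.Edge s s
  | source_middle : PathNode.Edge source middle
  | middle_sink : PathNode.Edge middle sink

/-- Disjoint paths of length two, one for each element of `ι`. -/
def pathsGraph (ι : Type) : ManipulationGraph (ι × PathNode) where
  Edge u v := u.1 = v.1 ∧ PathNode.Edge u.2 v.2
  self_loop u := ⟨rfl, .refl u.2⟩

open Classical in
/-- The hypothesis whose target is the path with index `i`: the middle nodes are positive, except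
that on the target path the sink is positive instead. -/
noncomputable def pathHyp {ι : Type} (i : ι) : ι × PathNode → Bool
  | (_, source) => false
  | (j, middle) => decide (j ≠ i)
  | (j, sink) => decide (j = i)

section Paths

variable {ι : Type}

theorem pathHyp_eq_of_ne (u : ι × PathNode) : ∃ i₀ b, ∀ i, i ≠ i₀ → pathHyp i u = b := by
  rcases u with ⟨j, _ | _ | _⟩
  · exact ⟨j, false, fun _ _ => rfl⟩
  · exact ⟨j, true, fun i hi => by simp [pathHyp, hi.symm]⟩
  · exact ⟨j, false, fun i hi => by simp [pathHyp, hi.symm]⟩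

theorem encard_outNbhd_paths_le (u : ι × PathNode) : ((pathsGraph ι).outNbhd u).encard ≤ 2 := by
  rcases u with ⟨j, s⟩
  have h : (pathsGraph ι).outNbhd (j, s) ⊆
      {(j, s), (j, match s with | source => middle | middle => sink | sink => sink)} := by
    rintro ⟨_, _⟩ ⟨rfl, _ | _ | _⟩ <;> simp
  exact (Set.encard_le_encard h).trans (encard_pair_le_two _ _)

theorem encard_inNbhd_paths_le (u : ι × PathNode) : ((pathsGraph ι).inNbhd u).encard ≤ 2 := by
  rcases u with ⟨j, s⟩
  have h : (pathsGraph ι).inNbhd (j, s) ⊆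
      {(j, s), (j, match s with | source => source | middle => source | sink => middle)} := by
    rintro ⟨_, _⟩ ⟨h, h'⟩
    dsimp only at h h'
    subst h
    cases h' <;> simp
  exact (Set.encard_le_encard h).trans (encard_pair_le_two _ _)

variable {F : ι × PathNode → ℝ} {i j : ι}

theorem sink_mem_bestResponse_sink : (j, sink) ∈ (pathsGraph ι).bestResponse F (j, sink) := by
  refine ⟨(pathsGraph ι).self_loop _, ?_⟩
  rintro ⟨_, _⟩ ⟨rfl, _ | _⟩
  exact le_rfl

theorem mem_bestResponse_of_edge {s s' t : PathNode} (h : PathNode.Edge s s') (hne : s ≠ s')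
    (ht : t = s ∨ t = s') (hs : F (j, s) ≤ F (j, t)) (hs' : F (j, s') ≤ F (j, t)) :
    (j, t) ∈ (pathsGraph ι).bestResponse F (j, s) := by
  constructor
  · rcases ht with rfl | rfl
    · exact (pathsGraph ι).self_loop _
    · exact ⟨rfl, h⟩
  · rintro ⟨_, _⟩ ⟨rfl, h'⟩
    cases h <;> cases h' <;> first | assumption | exact absurd rfl hne

theorem middle_mem_bestResponse_middle (h : F (j, sink) ≤ F (j, middle)) :
    (j, middle) ∈ (pathsGraph ι).bestResponse F (j, middle) :=
  mem_bestResponse_of_edge .middle_sink (by simp) (.inl rfl) le_rfl h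

theorem sink_mem_bestResponse_middle (h : F (j, middle) ≤ F (j, sink)) :
    (j, sink) ∈ (pathsGraph ι).bestResponse F (j, middle) :=
  mem_bestResponse_of_edge .middle_sink (by simp) (.inr rfl) h le_rfl

theorem middle_mem_bestResponse_source (h : F (j, source) ≤ F (j, middle)) :
    (j, middle) ∈ (pathsGraph ι).bestResponse F (j, source) :=
  mem_bestResponse_of_edge .source_middle (by simp) (.inr rfl) h le_rfl

theorem source_mem_bestResponse_source (h : F (j, middle) ≤ F (j, source)) :
    (j, source) ∈ (pathsGraph ι).bestResponse F (j, source) :=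
  mem_bestResponse_of_edge .source_middle (by simp) (.inl rfl) le_rfl h

/-- Agents at a middle node are positive under every hypothesis. -/
theorem label_middle (i j : ι) :
    ∀ w ∈ (pathsGraph ι).bestResponse (classifierValue (pathHyp i)) (j, middle),
      pathHyp i w = true := by
  by_cases h : j = i
  · exact ManipulationGraph.label_eq_true (w₀ := (j, sink)) ⟨rfl, .middle_sink⟩
      (by simp [pathHyp, h])
  · exact ManipulationGraph.label_eq_true (w₀ := (j, middle)) ⟨rfl, .refl _⟩ (by simp [pathHyp, h])

theorem label_sink_of_ne (h : j ≠ i) :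
    ∀ w ∈ (pathsGraph ι).bestResponse (classifierValue (pathHyp i)) (j, sink),
      pathHyp i w = false := by
  refine ManipulationGraph.label_eq_false ?_
  rintro ⟨_, _⟩ ⟨rfl, _ | _⟩
  simpa [pathHyp] using h

theorem label_sink_self (i : ι) :
    ∀ w ∈ (pathsGraph ι).bestResponse (classifierValue (pathHyp i)) (i, sink),
      pathHyp i w = true :=
  ManipulationGraph.label_eq_true (w₀ := (i, sink)) ⟨rfl, .refl _⟩ (by simp [pathHyp])

theorem label_source_self (i : ι) :
    ∀ w ∈ (pathsGraph ι).bestResponse (classifierValue (pathHyp i)) (i, source),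
      pathHyp i w = false := by
  refine ManipulationGraph.label_eq_false ?_
  rintro ⟨_, _⟩ ⟨rfl, _ | _ | _⟩ <;> simp [pathHyp]

variable {D : Type} {γ : ℝ} {A : DetLearner ((D × (ι × PathNode)) ⊕ ℕ)}

/-- A round outside the copies, which costs nothing and gives nothing away. -/
theorem exists_pass (γ : ℝ) (A : DetLearner ((D × (ι × PathNode)) ⊕ ℕ))
    (l : List (((D × (ι × PathNode)) ⊕ ℕ) × Bool)) :
    ∃ e, Forces ((pathsGraph ι).copies D (padGraph 2 2)) γ A (Set.range (copiesHyp pathHyp)) 0 l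
      (e :: l) := by
  have hout : ((pathsGraph ι).copies D (padGraph 2 2)).outNbhd (.inr 2) = {.inr 2} := by
    rw [ManipulationGraph.outNbhd_copies_inr, ← Set.image_singleton]
    congr 1
    ext n
    exact ⟨by rintro (rfl | h | h) <;> simp_all, fun h => .inl h.symm⟩
  refine ⟨(.inr 2, false), Forces.mono (Forces.step ?_) subset_rfl (Nat.zero_le _)⟩
  rintro _ ⟨f, rfl⟩
  refine ⟨.inr 2, ⟨by rw [hout]; rfl, fun w hw => ?_⟩,
    ManipulationGraph.label_eq_false fun w hw => ?_⟩
  · rw [hout] at hw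
    obtain rfl : w = _ := hw
    exact le_rfl
  · rw [hout] at hw
    obtain rfl : w = _ := hw
    rfl

/-- As long as a path is not known to be the target, any prediction on it other than a positive
middle node and a negative sink can be turned into a mistake that refutes only the hypothesis with
this target. -/
theorem exists_forces_of_deviation {k : D} {l : List (((D × (ι × PathNode)) ⊕ ℕ) × Bool)}
    (h : A l.reverse (.inl (k, (j, middle))) = false ∨ A l.reverse (.inl (k, (j, sink))) = true) :
    ∃ l', Forces ((pathsGraph ι).copies D (padGraph 2 2)) γ A
      (copiesHyp pathHyp '' {f | f k ∈ {i | j ≠ i}}) 1 l l' := by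
  cases hb : A l.reverse (.inl (k, (j, sink)))
  · have ha : A l.reverse (.inl (k, (j, middle))) = false := by simpa [hb] using h
    rcases le_total (memory γ A l (.inl (k, (j, sink)))) (memory γ A l (.inl (k, (j, middle))))
      with hm | hm
    · exact ⟨_, Forces.copies_mistake (b := true) (by rw [ha]; rfl) fun i _ =>
        ⟨_, middle_mem_bestResponse_middle hm, label_middle i j⟩⟩
    · exact ⟨_, Forces.copies_mistake (b := true) (by rw [hb]; rfl) fun i _ =>
        ⟨_, sink_mem_bestResponse_middle hm, label_middle i j⟩⟩
  · exact ⟨_, Forces.copies_mistake (b := false) (by rw [hb]; rfl) fun i hi =>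
      ⟨_, sink_mem_bestResponse_sink, label_sink_of_ne hi⟩⟩

/-- Passing for `n` rounds either gives an opportunity for a mistake or fills the memory of all
middle nodes, and empties that of all sinks, up to a fraction `γ ^ n`. -/
theorem exists_pass_until (hγ : 0 ≤ γ) (hγ1 : γ < 1) (S : Finset ι) (k : D) (n : ℕ)
    (l : List (((D × (ι × PathNode)) ⊕ ℕ) × Bool)) :
    ∃ l', Forces ((pathsGraph ι).copies D (padGraph 2 2)) γ A (Set.range (copiesHyp pathHyp))
        0 l l' ∧
      ((∃ j ∈ S, A l'.reverse (.inl (k, (j, middle))) = false ∨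
          A l'.reverse (.inl (k, (j, sink))) = true) ∨
        ∀ j ∈ S, (1 - γ)⁻¹ - memory γ A l' (.inl (k, (j, middle))) ≤ γ ^ n * (1 - γ)⁻¹ ∧
          memory γ A l' (.inl (k, (j, sink))) ≤ γ ^ n * (1 - γ)⁻¹) := by
  induction n with
  | zero =>
    refine ⟨l, Forces.refl l, .inr fun j _ => ?_⟩
    simp only [pow_zero, one_mul]
    exact ⟨by linarith [memory_nonneg hγ A l (.inl (k, (j, middle)))], memory_le hγ hγ1 A l _⟩
  | succ n ih =>
    obtain ⟨l', hl', h⟩ := ih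
    by_cases hdev : ∃ j ∈ S, A l'.reverse (.inl (k, (j, middle))) = false ∨
        A l'.reverse (.inl (k, (j, sink))) = true
    · exact ⟨l', hl', .inl hdev⟩
    obtain ⟨e, he⟩ := exists_pass γ A l'
    refine ⟨e :: l', hl'.trans he, .inr fun j hj => ?_⟩
    obtain ⟨h₁, h₂⟩ := (h.resolve_left hdev) j hj
    have hj' : A l'.reverse (.inl (k, (j, middle))) = true ∧
        A l'.reverse (.inl (k, (j, sink))) = false := by
      by_contra hne
      exact hdev ⟨j, hj, by simpa [imp_iff_not_or] using hne⟩
    have hS : γ * (1 - γ)⁻¹ + 1 = (1 - γ)⁻¹ := by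
      have : (1 : ℝ) - γ ≠ 0 := by linarith
      field_simp
      ring
    simp only [memory, classifierValue_of_true hj'.1, classifierValue_of_false hj'.2, pow_succ]
    have h₁' := mul_le_mul_of_nonneg_left h₁ hγ
    have h₂' := mul_le_mul_of_nonneg_left h₂ hγ
    constructor <;> nlinarith

/-- Once the target `i` is fixed, and as long as the memory of its middle node exceeds that of its
sink, the learner can avoid a mistake only if it predicts the middle node positive and the source
negative while the memory of the source exceeds that of the middle node.  This lead of the source
shrinks by one in such a round and grows by at most one in a round with a mistake, so with an
initial lead of at most `K` the number `p` of mistakes in `n` rounds satisfies `n ≤ 2 * p + K`. -/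
theorem exists_forces_of_target (hγ : 0 ≤ γ) (hγ1 : γ < 1) (k : D) (i : ι) (n K : ℕ)
    (l : List (((D × (ι × PathNode)) ⊕ ℕ) × Bool))
    (hD : 2 * (n : ℝ) - 2 ≤
      memory γ A l (.inl (k, (i, middle))) - memory γ A l (.inl (k, (i, sink))))
    (hK : memory γ A l (.inl (k, (i, source))) - memory γ A l (.inl (k, (i, middle))) ≤ K) :
    ∃ p l', Forces ((pathsGraph ι).copies D (padGraph 2 2)) γ A
      (copiesHyp pathHyp '' {f | f k ∈ ({i} : Set ι)}) p l l' ∧ n ≤ 2 * p + K := by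
  induction n generalizing K l with
  | zero => exact ⟨0, l, Forces.refl l, Nat.zero_le _⟩
  | succ n ih =>
    have hS : γ * (1 - γ)⁻¹ + 1 = (1 - γ)⁻¹ := by
      have : (1 : ℝ) - γ ≠ 0 := by linarith
      field_simp
      ring
    have hK0 : (0 : ℝ) ≤ K := Nat.cast_nonneg K
    -- The middle node loses at most two against the sink in each round.
    have hD' : ∀ e, 2 * (n : ℝ) - 2 ≤ memory γ A (e :: l) (.inl (k, (i, middle))) -
        memory γ A (e :: l) (.inl (k, (i, sink))) := by
      intro e
      have h1 := classifierValue_nonneg (A l.reverse) (.inl (k, (i, middle)))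
      have h2 := classifierValue_le_one (A l.reverse) (.inl (k, (i, sink)))
      have h3 := memory_le hγ hγ1 A l (.inl (k, (i, middle)))
      have h4 := memory_nonneg hγ A l (.inl (k, (i, sink)))
      simp only [memory]
      push_cast at hD
      have h5 : (1 - γ) * (memory γ A l (.inl (k, (i, middle))) -
          memory γ A l (.inl (k, (i, sink)))) ≤ 1 := by
        calc _ ≤ (1 - γ) * (1 - γ)⁻¹ := mul_le_mul_of_nonneg_left (by linarith) (by linarith)
          _ = 1 := mul_inv_cancel₀ (by linarith)
      linarith
    have hBA : memory γ A l (.inl (k, (i, sink))) ≤ memory γ A l (.inl (k, (i, middle))) := by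
      push_cast at hD
      have : (0 : ℝ) ≤ n := Nat.cast_nonneg n
      linarith
    have hγK : γ * (memory γ A l (.inl (k, (i, source))) -
        memory γ A l (.inl (k, (i, middle)))) ≤ K :=
      (mul_le_mul_of_nonneg_left hK hγ).trans (by nlinarith)
    have mistake : (∃ e, Forces ((pathsGraph ι).copies D (padGraph 2 2)) γ A
        (copiesHyp pathHyp '' {f | f k ∈ ({i} : Set ι)}) 1 l (e :: l)) →
        ∃ p l', Forces ((pathsGraph ι).copies D (padGraph 2 2)) γ A
          (copiesHyp pathHyp '' {f | f k ∈ ({i} : Set ι)}) p l l' ∧ n + 1 ≤ 2 * p + K := by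
      rintro ⟨e, he⟩
      obtain ⟨p, l', hl', hp⟩ := ih (K + 1) (e :: l) (hD' e) (by
        have h1 := classifierValue_nonneg (A l.reverse) (.inl (k, (i, middle)))
        have h2 := classifierValue_le_one (A l.reverse) (.inl (k, (i, source)))
        simp only [memory]
        push_cast
        linarith)
      exact ⟨1 + p, l', he.trans hl', by omega⟩
    cases hb : A l.reverse (.inl (k, (i, sink)))
    · refine mistake ⟨_, Forces.copies_mistake (b := true) (by rw [hb]; rfl) ?_⟩
      rintro i rfl
      exact ⟨_, sink_mem_bestResponse_sink, label_sink_self i⟩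
    cases ha : A l.reverse (.inl (k, (i, middle)))
    · refine mistake ⟨_, Forces.copies_mistake (b := true) (by rw [ha]; rfl) ?_⟩
      rintro i rfl
      exact ⟨_, middle_mem_bestResponse_middle hBA, label_middle i i⟩
    rcases le_or_gt (memory γ A l (.inl (k, (i, source)))) (memory γ A l (.inl (k, (i, middle))))
      with hm | hm
    · refine mistake ⟨_, Forces.copies_mistake (b := false) (by rw [ha]; rfl) ?_⟩
      rintro i rfl
      exact ⟨_, middle_mem_bestResponse_source hm, label_source_self i⟩
    cases hc : A l.reverse (.inl (k, (i, source)))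
    · obtain ⟨e, he⟩ := exists_pass γ A l
      -- The lead of the source is positive here, so `K` is not zero.
      obtain ⟨K, rfl⟩ : ∃ K', K = K' + 1 := Nat.exists_eq_succ_of_ne_zero (by
        rintro rfl
        push_cast at hK
        linarith)
      obtain ⟨p, l', hl', hp⟩ := ih K (e :: l) (hD' e) (by
        simp only [memory, classifierValue_of_true ha, classifierValue_of_false hc]
        push_cast at hγK
        linarith)
      exact ⟨0 + p, l', (he.mono (Set.image_subset_range _ _) le_rfl).trans hl', by omega⟩
    · refine mistake ⟨_, Forces.copies_mistake (b := false) (by rw [hc]; rfl) ?_⟩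
      rintro i rfl
      exact ⟨_, source_mem_bestResponse_source hm.le, label_source_self i⟩

/-- The adversary uses up hypotheses one by one until either a single one is left or the memory
speaks clearly against some remaining target, which is then fixed. -/
theorem exists_forces_paths (hγ : 0 ≤ γ) (hγ1 : γ < 1) {q : ℕ}
    (hq : 4 * (q : ℝ) ≤ (1 - γ)⁻¹ - 1 / 2) (k : D) (n : ℕ) (S : Finset ι) (hS : n < S.card)
    (l : List (((D × (ι × PathNode)) ⊕ ℕ) × Bool)) :
    ∃ i ∈ S, ∃ l', Forces ((pathsGraph ι).copies D (padGraph 2 2)) γ A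
      (copiesHyp pathHyp '' {f | f k = i}) (min n (q + 1)) l l' := by
  classical
  have hS0 : (0 : ℝ) < (1 - γ)⁻¹ := inv_pos.2 (by linarith)
  have hSeq : γ * (1 - γ)⁻¹ + 1 = (1 - γ)⁻¹ := by
    have : (1 : ℝ) - γ ≠ 0 := by linarith
    field_simp
    ring
  induction n generalizing S l with
  | zero =>
    obtain ⟨i, hi⟩ := Finset.card_pos.1 hS
    exact ⟨i, hi, l, (Forces.refl l).mono subset_rfl (by simp)⟩
  | succ n ih =>
    obtain ⟨L, hL⟩ : ∃ L, γ ^ L * (1 - γ)⁻¹ < 1 / 4 := by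
      obtain ⟨L, hL⟩ := exists_pow_lt_of_lt_one (show 0 < 1 / 4 / (1 - γ)⁻¹ by positivity) hγ1
      exact ⟨L, (lt_div_iff₀ hS0).1 hL⟩
    obtain ⟨l₁, hl₁, h⟩ := exists_pass_until (A := A) hγ hγ1 S k L l
    by_cases hdev : ∃ j ∈ S, A l₁.reverse (.inl (k, (j, middle))) = false ∨
        A l₁.reverse (.inl (k, (j, sink))) = true
    · obtain ⟨j, -, hj⟩ := hdev
      obtain ⟨l₂, hl₂⟩ := exists_forces_of_deviation (γ := γ) hj
      obtain ⟨i, hi, l₃, hl₃⟩ := ih (S.erase j)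
        (by have := Finset.pred_card_le_card_erase (s := S) (a := j); omega) l₂
      refine ⟨i, Finset.mem_of_mem_erase hi, l₃,
        (((hl₁.mono (Set.image_subset_range _ _) le_rfl).trans
          (hl₂.mono (Set.image_mono ?_) le_rfl)).trans hl₃).mono subset_rfl (by omega)⟩
      rintro f rfl
      exact (Finset.ne_of_mem_erase hi).symm
    · obtain ⟨i, hi⟩ := Finset.card_pos.1 (by omega : 0 < S.card)
      obtain ⟨h₁, h₂⟩ := (h.resolve_left hdev) i hi
      have hi' : A l₁.reverse (.inl (k, (i, middle))) = true ∧
          A l₁.reverse (.inl (k, (i, sink))) = false := by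
        by_contra hne
        exact hdev ⟨i, hi, by simpa [imp_iff_not_or] using hne⟩
      -- The first mistake on the target is for free, as its sink is predicted negative.
      have hl₂ : Forces ((pathsGraph ι).copies D (padGraph 2 2)) γ A
          (copiesHyp pathHyp '' {f | f k ∈ ({i} : Set ι)}) 1 l₁
          ((.inl (k, (i, sink)), true) :: l₁) := by
        refine Forces.copies_mistake (by rw [hi'.2]; rfl) ?_
        rintro i rfl
        exact ⟨_, sink_mem_bestResponse_sink, label_sink_self i⟩
      have hB0 := memory_nonneg hγ A l₁ (.inl (k, (i, sink)))
      have h₁' : γ * ((1 - γ)⁻¹ - memory γ A l₁ (.inl (k, (i, middle)))) ≤ 1 / 4 :=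
        (mul_le_mul_of_nonneg_left (h₁.trans hL.le) hγ).trans (by linarith)
      have h₂' : γ * memory γ A l₁ (.inl (k, (i, sink))) ≤ 1 / 4 :=
        (mul_le_mul_of_nonneg_left (h₂.trans hL.le) hγ).trans (by linarith)
      have hC := memory_le hγ hγ1 A ((.inl (k, (i, sink)), true) :: l₁) (.inl (k, (i, source)))
      obtain ⟨p, l₃, hl₃, hp⟩ := exists_forces_of_target (A := A) hγ hγ1 k i (2 * q + 1) 1
        ((.inl (k, (i, sink)), true) :: l₁)
        (by
          simp only [memory, classifierValue_of_true hi'.1, classifierValue_of_false hi'.2]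
          push_cast
          linarith)
        (by
          refine (sub_le_sub_right hC _).trans ?_
          simp only [memory, classifierValue_of_true hi'.1]
          push_cast
          linarith)
      exact ⟨i, hi, l₃, ((hl₁.mono (Set.image_subset_range _ _) le_rfl).trans
        (hl₂.trans hl₃)).mono subset_rfl (by omega)⟩

end Paths

theorem copiesHyp_pathHyp_injective {D Z ι : Type} :
    Function.Injective
      (copiesHyp pathHyp : (D → ι) → (D × (ι × PathNode)) ⊕ Z → Bool) := by
  intro f f' h
  ext k
  have := congrFun h (.inl (k, (f k, sink)))
  simpa [copiesHyp, pathHyp] using this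

/-- The lower bound for the paths, with `N` base hypotheses. -/
theorem exists_class_of_paths {N : ℕ} (hN : 2 ≤ N) (d : ℕ) {γ : ℝ} (hγ : 0 ≤ γ) (hγ1 : γ < 1)
    {q : ℕ} (hq : 4 * (q : ℝ) ≤ (1 - γ)⁻¹ - 1 / 2) :
    ∃ (X : Type) (G : ManipulationGraph X) (H : Set (X → Bool)),
      H.Finite ∧ H.Nonempty ∧ H.ncard = N ^ d ∧ littlestoneDim H = (d : ℕ∞) ∧
      G.maxInDegree = 2 ∧ G.maxOutDegree = 2 ∧ ∀ A : DetLearner X,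
        ((d * min (N - 1) (q + 1) : ℕ) : ℕ∞) ≤ weightedMistakeBound G H γ A := by
  have : Nonempty (Fin N) := ⟨⟨0, by omega⟩⟩
  refine ⟨_, (pathsGraph (Fin N)).copies (Fin d) (padGraph 2 2), Set.range (copiesHyp pathHyp),
    Set.finite_range _, Set.range_nonempty _, ?_, ?_, ?_, ?_, fun A => ?_⟩
  · rw [← Set.image_univ, Set.ncard_image_of_injective _ copiesHyp_pathHyp_injective,
      Set.ncard_univ, Nat.card_fun, Nat.card_fin, Nat.card_fin]
  · have h := littlestoneDim_copies (D := Fin d) (Z := ℕ) (pathHyp_eq_of_ne (ι := Fin N))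
      (y₀ := (⟨0, by omega⟩, sink)) (i := fun b => if b then ⟨0, by omega⟩ else ⟨1, by omega⟩)
      (by rintro (_ | _) <;> simp [pathHyp])
    rwa [Fintype.card_fin] at h
  · have h2 := maxInDegree_padGraph (n := 2) (m := 2) le_rfl
    rw [ManipulationGraph.maxInDegree_copies, h2]
    · rfl
    · rw [h2]
      exact encard_inNbhd_paths_le
  · have h2 := maxOutDegree_padGraph (n := 2) (m := 2) le_rfl
    rw [ManipulationGraph.maxOutDegree_copies, h2]
    · rfl
    · rw [h2]
      exact encard_outNbhd_paths_le
  · have h := card_mul_le_weightedMistakeBound hγ (A := A) (P := padGraph 2 2) (fun k l => by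
      obtain ⟨i, -, l', hl'⟩ := exists_forces_paths (A := A) hγ hγ1 hq k (N - 1) Finset.univ
        (by rw [Finset.card_univ, Fintype.card_fin]; omega) l
      exact ⟨i, l', hl'⟩)
    rwa [Fintype.card_fin] at h

/-! ### Points and lines: the game against short memory -/

/-- Nodes of the graph of points and lines.  The lines come in classes, with `C` the set of classes,
and class `c` consists of the lines `(c, some r)` and of an empty line `(c, none)`.  Besides
the points of `P` there is an isolated point `none`. -/
abbrev DesignNode (P C R : Type) : Type := Option P ⊕ (C × Option R)

/-- The graph of points and lines.  The line of class `c` through the point `p` is `some (ρ c p)`.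
A line can move to its points and to all lines of its class; a point cannot move. -/
def designGraph {P C R : Type} (ρ : C → P → R) : ManipulationGraph (DesignNode P C R) where
  Edge
    | .inl p, .inl q => p = q
    | .inl _, .inr _ => False
    | .inr a, .inl q => ∃ p, q = some p ∧ a.2 = some (ρ a.1 p)
    | .inr a, .inr a' => a.1 = a'.1
  self_loop
    | .inl _ => rfl
    | .inr _ => rfl

open Classical in
/-- The hypothesis that is positive exactly at the point `i`. -/
noncomputable def pointHyp {P C R : Type} (i : Option P) : DesignNode P C R → Bool
  | .inl p => decide (p = i)
  | .inr _ => false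

theorem pointHyp_inl_self {P C R : Type} (i : Option P) :
    pointHyp i (.inl i : DesignNode P C R) = true := by simp [pointHyp]

theorem pointHyp_inl_of_ne {P C R : Type} {i p : Option P} (h : p ≠ i) :
    pointHyp i (.inl p : DesignNode P C R) = false := by simp [pointHyp, h]

theorem pointHyp_eq_of_ne {P C R : Type} (y : DesignNode P C R) :
    ∃ i₀ b, ∀ i, i ≠ i₀ → pointHyp i y = b := by
  rcases y with p | a
  · exact ⟨p, false, fun i hi => pointHyp_inl_of_ne hi.symm⟩
  · exact ⟨none, false, fun _ _ => rfl⟩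

theorem encard_range_le {α β : Type} [Finite α] (f : α → β) :
    (Set.range f).encard ≤ Nat.card α := by
  rw [← Set.image_univ, ← ENat.card_eq_coe_natCard, ← Set.encard_univ]
  exact Set.encard_image_le _ _

section Design

variable {P C R : Type} {ρ : C → P → R}

theorem mem_bestResponse_point (F : DesignNode P C R → ℝ) (p : Option P) :
    Sum.inl p ∈ (designGraph ρ).bestResponse F (.inl p) := by
  refine ⟨(designGraph ρ).self_loop (.inl p), ?_⟩
  rintro (q | a) h
  · obtain rfl : p = q := h
    exact le_rfl
  · exact h.elim

/-- An agent at a point has the label of that point. -/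
theorem label_point (i p : Option P) {b : Bool}
    (hb : pointHyp i (.inl p : DesignNode P C R) = b) :
    ∀ w ∈ (designGraph ρ).bestResponse (classifierValue (pointHyp i)) (.inl p),
      pointHyp i w = b := by
  rintro (q | a) ⟨h, -⟩
  · obtain rfl : p = q := h
    exact hb
  · exact h.elim

theorem label_empty_line (i : Option P) (c : C) :
    ∀ w ∈ (designGraph ρ).bestResponse (classifierValue (pointHyp i)) (.inr (c, none)),
      pointHyp i w = false := by
  refine ManipulationGraph.label_eq_false ?_
  rintro (q | a) h
  · obtain ⟨p, -, hp⟩ := h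
    cases hp
  · rfl

theorem label_line (p : P) (c : C) :
    ∀ w ∈ (designGraph ρ).bestResponse (classifierValue (pointHyp (some p)))
      (.inr (c, some (ρ c p))), pointHyp (some p) w = true :=
  ManipulationGraph.label_eq_true (w₀ := .inl (some p)) ⟨p, rfl, rfl⟩ (pointHyp_inl_self _)

variable {D Z : Type} {pad : ManipulationGraph Z} {γ : ℝ}
  {A : DetLearner ((D × DesignNode P C R) ⊕ Z)}

/-- Two hypotheses suffice to force one mistake. -/
theorem exists_forces_one_design [Nonempty P] (k : D)
    (l : List (((D × DesignNode P C R) ⊕ Z) × Bool)) :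
    ∃ i l', Forces ((designGraph ρ).copies D pad) γ A
      (copiesHyp pointHyp '' {f | f k = i}) 1 l l' := by
  obtain ⟨p₀⟩ := ‹Nonempty P›
  -- An agent at the isolated point gets the label opposite to the prediction.
  cases hA : A l.reverse (.inl (k, .inl none))
  · refine ⟨none, _, Forces.copies_mistake (S := {none}) (b := true) (by rw [hA]; rfl) ?_⟩
    rintro i rfl
    exact ⟨_, mem_bestResponse_point _ _, label_point _ _ (pointHyp_inl_self _)⟩
  · refine ⟨some p₀, _, Forces.copies_mistake (S := {some p₀}) (b := false) (by rw [hA]; rfl) ?_⟩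
    rintro i rfl
    exact ⟨_, mem_bestResponse_point _ _, label_point _ _ (pointHyp_inl_of_ne (by simp))⟩

/-- Every round can be made a mistake that refutes at most one point.  Let `w` be a node, other than
the isolated point, where the memory is maximal.  If `w` is predicted negative, then for every point
`p` some line through `p` sees `w`, moves there and has a positive label.  If `w` is predicted
positive, then either `w` is a line, and the empty line of its class moves there with a negative
label, or `w` is a point, and a negative label at `w` refutes just this point. -/
theorem exists_forces_design_step [Finite P] [Finite C] [Finite R] [Nonempty P]
    (hρ : ∀ p q, ∃ c, ρ c p = ρ c q) (k : D) (l : List (((D × DesignNode P C R) ⊕ Z) × Bool)) :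
    ∃ (p₀ : P) (l' : List (((D × DesignNode P C R) ⊕ Z) × Bool)),
      Forces ((designGraph ρ).copies D pad) γ A
        (copiesHyp pointHyp '' {f | f k ∈ {i | ∃ p, p ≠ p₀ ∧ i = some p}}) 1 l l' := by
  let F : DesignNode P C R → ℝ := fun z => memory γ A l (.inl (k, z))
  obtain ⟨w, hw⟩ := Finite.exists_max
    (fun w : P ⊕ (C × Option R) => F (Sum.map some id w))
  have hline : ∀ a, Sum.map some id w ∈ (designGraph ρ).outNbhd (.inr a) →
      Sum.map some id w ∈ (designGraph ρ).bestResponse F (.inr a) := by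
    refine fun a ha => ⟨ha, ?_⟩
    rintro (q | a') h
    · obtain ⟨p, rfl, -⟩ := h
      exact hw (.inl p)
    · exact hw (.inr a')
  cases hA : A l.reverse (.inl (k, Sum.map some id w))
  · refine ⟨Classical.arbitrary P, _, Forces.copies_mistake (b := true) (by rw [hA]; rfl) ?_⟩
    rintro _ ⟨p, -, rfl⟩
    rcases w with q | a
    · obtain ⟨c, hc⟩ := hρ p q
      exact ⟨_, hline (c, some (ρ c p)) ⟨q, rfl, by simp [hc]⟩, label_line p c⟩
    · exact ⟨_, hline (a.1, some (ρ a.1 p)) rfl, label_line p a.1⟩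
  · rcases w with q | a
    · refine ⟨q, _, Forces.copies_mistake (b := false) (by rw [hA]; rfl) ?_⟩
      rintro _ ⟨p, hp, rfl⟩
      exact ⟨_, mem_bestResponse_point _ _,
        label_point _ _ (pointHyp_inl_of_ne (by simpa using hp.symm))⟩
    · refine ⟨Classical.arbitrary P, _, Forces.copies_mistake (b := false) (by rw [hA]; rfl) ?_⟩
      rintro _ ⟨p, -, rfl⟩
      exact ⟨_, hline (a.1, none) rfl, label_empty_line _ _⟩

theorem exists_forces_design_of_finset [Finite P] [Finite C] [Finite R]
    (hρ : ∀ p q, ∃ c, ρ c p = ρ c q) (k : D) (n : ℕ) (S : Finset P) (hS : n < S.card)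
    (l : List (((D × DesignNode P C R) ⊕ Z) × Bool)) :
    ∃ p ∈ S, ∃ l', Forces ((designGraph ρ).copies D pad) γ A
      (copiesHyp pointHyp '' {f | f k = some p}) n l l' := by
  classical
  induction n generalizing S l with
  | zero =>
    obtain ⟨p, hp⟩ := Finset.card_pos.1 hS
    exact ⟨p, hp, l, Forces.refl l⟩
  | succ n ih =>
    have : Nonempty P := (Finset.card_pos.1 (by omega : 0 < S.card)).to_subtype.map Subtype.val
    obtain ⟨p₀, l₁, h₁⟩ := exists_forces_design_step (pad := pad) (γ := γ) (A := A) hρ k l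
    obtain ⟨p, hp, l₂, h₂⟩ := ih (S.erase p₀)
      (by have := Finset.pred_card_le_card_erase (s := S) (a := p₀); omega) l₁
    refine ⟨p, Finset.mem_of_mem_erase hp, l₂, ?_⟩
    refine ((h₁.mono (Set.image_mono ?_) le_rfl).trans h₂).mono subset_rfl (by omega)
    exact fun f hf => ⟨p, Finset.ne_of_mem_erase hp, hf⟩

theorem exists_forces_design [Finite P] [Finite C] [Finite R] [Nonempty P]
    (hρ : ∀ p q, ∃ c, ρ c p = ρ c q) (k : D) (l : List (((D × DesignNode P C R) ⊕ Z) × Bool)) :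
    ∃ i l', Forces ((designGraph ρ).copies D pad) γ A
      (copiesHyp pointHyp '' {f | f k = i}) (max 1 (Nat.card P - 1)) l l' := by
  have := Fintype.ofFinite P
  rcases le_total (Nat.card P - 1) 1 with h | h
  · rw [max_eq_left h]
    exact exists_forces_one_design k l
  · rw [max_eq_right h]
    obtain ⟨p, -, l', hl'⟩ := exists_forces_design_of_finset (pad := pad) (γ := γ) (A := A) hρ k
      (Nat.card P - 1) Finset.univ (by
        rw [Finset.card_univ, ← Nat.card_eq_fintype_card]
        have := Nat.card_pos (α := P)
        omega) l
    exact ⟨some p, l', hl'⟩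

theorem encard_outNbhd_design_le [Finite R] {f m : ℕ}
    (hf : ∀ c r, {p | ρ c p = r}.encard ≤ (f : ℕ∞)) (hm : Nat.card R + 1 + f ≤ m)
    (y : DesignNode P C R) : ((designGraph ρ).outNbhd y).encard ≤ m := by
  rcases y with p | ⟨c, r⟩
  · have h : (designGraph ρ).outNbhd (.inl p) ⊆ {.inl p} := by
      rintro (q | a) h
      · obtain rfl : p = q := h
        rfl
      · exact h.elim
    refine (Set.encard_le_encard h).trans ?_
    rw [Set.encard_singleton]
    exact_mod_cast (by omega : 1 ≤ m)
  · have h : (designGraph ρ).outNbhd (.inr (c, r)) ⊆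
        Set.range (fun r' : Option R => Sum.inr (c, r')) ∪
          (fun p => Sum.inl (some p)) '' {p | some (ρ c p) = r} := by
      rintro (q | ⟨c', r'⟩) h
      · obtain ⟨p, rfl, hp⟩ := h
        exact .inr ⟨p, hp.symm, rfl⟩
      · obtain rfl : c = c' := h
        exact .inl ⟨r', rfl⟩
    have hr : {p | some (ρ c p) = r}.encard ≤ (f : ℕ∞) := by
      rcases r with _ | r
      · simp
      · simpa using hf c r
    refine (Set.encard_le_encard h).trans ((Set.encard_union_le _ _).trans ?_)
    refine (add_le_add (encard_range_le _) ((Set.encard_image_le _ _).trans hr)).trans ?_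
    rw [Finite.card_option]
    exact_mod_cast hm

theorem encard_inNbhd_design_le [Finite C] [Finite R] {n : ℕ} (hC : Nat.card C + 1 ≤ n)
    (hR : Nat.card R + 1 ≤ n) (y : DesignNode P C R) :
    ((designGraph ρ).inNbhd y).encard ≤ n := by
  rcases y with q | ⟨c, r⟩
  · have h : (designGraph ρ).inNbhd (.inl q) ⊆ insert (.inl q)
        (Set.range fun c : C => Sum.inr (c, q.map (ρ c))) := by
      rintro (p | ⟨c, r⟩) h
      · obtain rfl : p = q := h
        exact .inl rfl
      · obtain ⟨p, rfl, hp⟩ := h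
        obtain rfl : r = some (ρ c p) := hp
        exact .inr ⟨c, rfl⟩
    refine (Set.encard_le_encard h).trans ((Set.encard_insert_le _ _).trans ?_)
    refine (add_le_add (encard_range_le _) le_rfl).trans ?_
    exact_mod_cast hC
  · have h : (designGraph ρ).inNbhd (.inr (c, r)) ⊆
        Set.range (fun r' : Option R => Sum.inr (c, r')) := by
      rintro (q | ⟨c', r'⟩) h
      · exact h.elim
      · obtain rfl : c' = c := h
        exact ⟨r', rfl⟩
    refine (Set.encard_le_encard h).trans ((encard_range_le _).trans ?_)
    rw [Finite.card_option]
    exact_mod_cast hR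

/-- The lower bound for points and lines: `f` bounds the number of points on a line.  It is valid
for every discount factor. -/
theorem exists_class_of_design [Finite P] [Finite C] [Finite R] [Nonempty P]
    (hρ : ∀ p q, ∃ c, ρ c p = ρ c q) {f n m : ℕ}
    (hf : ∀ c r, {p | ρ c p = r}.encard ≤ (f : ℕ∞)) (hC : Nat.card C + 1 ≤ n)
    (hR : Nat.card R + 1 ≤ n) (hm : Nat.card R + 1 + f ≤ m) (hn2 : 2 ≤ n) (hm2 : 2 ≤ m) (d : ℕ) :
    ∃ (X : Type) (G : ManipulationGraph X) (H : Set (X → Bool)),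
      H.Nonempty ∧ littlestoneDim H = (d : ℕ∞) ∧ G.maxInDegree = (n : ℕ∞) ∧
      G.maxOutDegree = (m : ℕ∞) ∧ ∀ γ : ℝ, 0 ≤ γ → ∀ A : DetLearner X,
        ((d * max 1 (Nat.card P - 1) : ℕ) : ℕ∞) ≤ weightedMistakeBound G H γ A := by
  refine ⟨_, (designGraph ρ).copies (Fin d) (padGraph n m), Set.range (copiesHyp pointHyp),
    Set.range_nonempty _, ?_, ?_, ?_, fun γ hγ A => ?_⟩
  · have h := littlestoneDim_copies (D := Fin d) (Z := ℕ) (pointHyp_eq_of_ne (P := P) (C := C)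
      (R := R)) (y₀ := .inl none) (i := fun b => if b then none else some (Classical.arbitrary P))
      (by rintro (_ | _) <;> simp [pointHyp])
    rwa [Fintype.card_fin] at h
  · rw [ManipulationGraph.maxInDegree_copies, maxInDegree_padGraph hn2]
    rw [maxInDegree_padGraph hn2]
    exact encard_inNbhd_design_le hC hR
  · rw [ManipulationGraph.maxOutDegree_copies, maxOutDegree_padGraph hm2]
    rw [maxOutDegree_padGraph hm2]
    exact encard_outNbhd_design_le hf hm
  · have h := card_mul_le_weightedMistakeBound hγ (A := A) (P := padGraph n m)
      (fun k l => exists_forces_design hρ k l)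
    rwa [Fintype.card_fin] at h

end Design

/-- The parallel classes of the affine plane over `F`, every point of which is replaced by a
cluster with index set `T`.  The lines of class `some a` have slope `a`; class `none` consists of
the vertical lines.  The value is the intercept of the line through the given point. -/
def affineIntercept {F T : Type} [Field F] : Option F → (F × F) × T → F
  | some a, p => p.1.2 - a * p.1.1
  | none, p => p.1.1

theorem exists_affineIntercept_eq {F T : Type} [Field F] (p q : (F × F) × T) :
    ∃ c, affineIntercept c p = affineIntercept c q := by
  by_cases h : p.1.1 = q.1.1
  · exact ⟨none, h⟩
  · have h' : p.1.1 - q.1.1 ≠ 0 := sub_ne_zero.2 h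
    refine ⟨some ((p.1.2 - q.1.2) / (p.1.1 - q.1.1)), ?_⟩
    simp only [affineIntercept]
    field_simp
    ring

theorem encard_affineIntercept_fiber_le {F T : Type} [Field F] [Finite F] [Finite T]
    (c : Option F) (r : F) :
    {p : (F × F) × T | affineIntercept c p = r}.encard ≤ ((Nat.card F * Nat.card T : ℕ) : ℕ∞) := by
  rw [← Nat.card_prod]
  rcases c with _ | a
  · refine (Set.encard_le_encard ?_).trans (encard_range_le fun s : F × T => ((r, s.1), s.2))
    rintro ⟨⟨x, y⟩, t⟩ h
    obtain rfl : x = r := h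
    exact ⟨(y, t), rfl⟩
  · refine (Set.encard_le_encard ?_).trans
      (encard_range_le fun s : F × T => ((s.1, r + a * s.1), s.2))
    rintro ⟨⟨x, y⟩, t⟩ h
    obtain rfl : y - a * x = r := h
    exact ⟨(x, t), by simp⟩

/-- The number of points is of order `n * m`, for an affine plane over a field of prime order `q`
between `n / 8` and `n / 4` with clusters of size about `m / q`, or for a single line when `n` is
small. -/
theorem exists_class_with_degrees {n m : ℕ} (hn : 2 ≤ n) (hnm : n < m) (d : ℕ) :
    ∃ (X : Type) (G : ManipulationGraph X) (H : Set (X → Bool)),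
      H.Nonempty ∧ littlestoneDim H = (d : ℕ∞) ∧ G.maxInDegree = (n : ℕ∞) ∧
      G.maxOutDegree = (m : ℕ∞) ∧ ∀ γ : ℝ, 0 ≤ γ → ∀ A : DetLearner X,
        ENNReal.ofReal (1 / 50 * ((d : ℝ) * n * m)) ≤
          (weightedMistakeBound G H γ A : ℝ≥0∞) := by
  obtain ⟨N, hN, hN1, X, G, H, h1, h2, h3, h4, h5⟩ : ∃ N : ℕ, n * m ≤ 25 * N ∧ 1 ≤ N ∧
      ∃ (X : Type) (G : ManipulationGraph X) (H : Set (X → Bool)),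
      H.Nonempty ∧ littlestoneDim H = (d : ℕ∞) ∧ G.maxInDegree = (n : ℕ∞) ∧
      G.maxOutDegree = (m : ℕ∞) ∧ ∀ γ : ℝ, 0 ≤ γ → ∀ A : DetLearner X,
        ((d * max 1 (N - 1) : ℕ) : ℕ∞) ≤ weightedMistakeBound G H γ A := by
    rcases lt_or_ge n 8 with h8 | h8
    · refine ⟨m - 2, ?_, by omega, ?_⟩
      · have : n * m ≤ 7 * m := Nat.mul_le_mul_right _ (by omega)
        omega
      · have : Nonempty (Fin (m - 2)) := ⟨⟨0, by omega⟩⟩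
        have h := exists_class_of_design (P := Fin (m - 2)) (C := Unit) (R := Unit)
          (ρ := fun _ _ => ()) (fun _ _ => ⟨(), rfl⟩) (f := m - 2) (n := n) (m := m)
          (fun _ _ => by simp) (by simp; omega) (by simp; omega) (by simp; omega) hn (by omega) d
        rwa [Nat.card_fin] at h
    · obtain ⟨q, hq, hq1, hq2⟩ := Nat.exists_prime_lt_and_le_two_mul (n / 8) (by omega)
      have : Fact q.Prime := ⟨hq⟩
      have hq0 := hq.two_le
      -- The out-degree of a line is `q + 1 + q * s`.
      set s := (m - q - 1) / q with hs
      have hs1 : q * s ≤ m - q - 1 := Nat.mul_div_le _ _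
      have hs2 : m - q - 1 < q * (s + 1) := Nat.lt_mul_div_succ _ (by omega)
      have hs3 : m ≤ 2 * (q * s) := by rw [Nat.mul_succ] at hs2; omega
      have hs0 : 0 < s := Nat.pos_of_ne_zero (by rintro h0; rw [h0] at hs3; omega)
      have : Nonempty (Fin s) := ⟨⟨0, hs0⟩⟩
      refine ⟨q * q * s, ?_, Nat.mul_pos (Nat.mul_pos hq.pos hq.pos) hs0, ?_⟩
      · calc n * m ≤ (8 * q) * (2 * (q * s)) := Nat.mul_le_mul (by omega) hs3
          _ = 16 * (q * q * s) := by ring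
          _ ≤ 25 * (q * q * s) := Nat.mul_le_mul_right _ (by norm_num)
      · have h := exists_class_of_design (P := (ZMod q × ZMod q) × Fin s) (C := Option (ZMod q))
          (ρ := affineIntercept) exists_affineIntercept_eq (n := n) (m := m)
          encard_affineIntercept_fiber_le (by rw [Finite.card_option, Nat.card_zmod]; omega)
          (by rw [Nat.card_zmod]; omega) (by rw [Nat.card_zmod, Nat.card_fin]; omega) hn
          (by omega) d
        rwa [Nat.card_prod, Nat.card_prod, Nat.card_zmod, Nat.card_fin] at h
  refine ⟨X, G, H, h1, h2, h3, h4, fun γ hγ A => ofReal_le_toENNReal ?_ (h5 γ hγ A)⟩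
  have hN' : n * m ≤ 50 * max 1 (N - 1) := by omega
  have hN'' : (n : ℝ) * m ≤ 50 * (max 1 (N - 1) : ℕ) := by exact_mod_cast hN'
  push_cast at hN'' ⊢
  nlinarith [mul_le_mul_of_nonneg_left hN'' (Nat.cast_nonneg (α := ℝ) d)]

/-! ### The two lower bounds -/

theorem mainTheorem3 :
    (∃ c : ℝ, 0 < c ∧ ∀ (d N : ℕ) (γ : ℝ), 2 ≤ N → 0 < γ → γ < 1 →
      ∃ (X : Type) (G : ManipulationGraph X) (H : Set (X → Bool)),
        H.Finite ∧ H.Nonempty ∧ (1 ≤ d → N ≤ H.ncard) ∧ (d = 1 → H.ncard = N) ∧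
        littlestoneDim H = (d : ℕ∞) ∧ G.maxInDegree = 2 ∧ G.maxOutDegree = 2 ∧
        ∀ A : DetLearner X,
          ENNReal.ofReal (c * min ((d : ℝ) * (1 - γ)⁻¹) (H.ncard : ℝ)) ≤
            (weightedMistakeBound G H γ A : ℝ≥0∞)) ∧
    (∀ ε : ℝ, 0 < ε → ∃ c : ℝ, 0 < c ∧ ∀ d kin kout : ℕ, 2 ≤ kin →
      (1 + ε) * (kin : ℝ) ≤ (kout : ℝ) →
      ∃ (X : Type) (G : ManipulationGraph X) (H : Set (X → Bool)),
        H.Nonempty ∧ littlestoneDim H = (d : ℕ∞) ∧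
        G.maxInDegree = (kin : ℕ∞) ∧ G.maxOutDegree = (kout : ℕ∞) ∧
        ∃ γ₀ : ℝ, 0 < γ₀ ∧ ∀ γ : ℝ, 0 ≤ γ → γ < γ₀ → ∀ A : DetLearner X,
          ENNReal.ofReal (c * ((d : ℝ) * (kin : ℝ) * (kout : ℝ))) ≤
            (weightedMistakeBound G H γ A : ℝ≥0∞)) := by
  constructor
  · refine ⟨1 / 8, by norm_num, fun d N γ hN hγ hγ1 => ?_⟩
    have hS : (1 : ℝ) ≤ (1 - γ)⁻¹ := one_le_inv_iff₀.2 ⟨by linarith, by linarith⟩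
    set q := ⌊((1 - γ)⁻¹ - 1 / 2) / 4⌋₊
    have hq1 : (q : ℝ) ≤ ((1 - γ)⁻¹ - 1 / 2) / 4 := Nat.floor_le (by linarith)
    have hq2 : ((1 - γ)⁻¹ - 1 / 2) / 4 < q + 1 := Nat.lt_floor_add_one _
    -- With one copy the class must have exactly `N` elements; with more copies there is room for
    -- so many base hypotheses that their number does not limit the mistakes.
    obtain ⟨N', hN', hN1, hN2⟩ : ∃ N', N ≤ N' ∧ (d = 1 → N' = N) ∧ (d ≠ 1 → q + 2 ≤ N') := by
      by_cases hd : d = 1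
      · exact ⟨N, le_rfl, fun _ => rfl, fun h => absurd hd h⟩
      · exact ⟨N + q, by omega, fun h => absurd h hd, fun _ => by omega⟩
    obtain ⟨X, G, H, h1, h2, h3, h4, h5, h6, h7⟩ :=
      exists_class_of_paths (hN.trans hN') d hγ.le hγ1 (q := q) (by linarith)
    refine ⟨X, G, H, h1, h2, fun hd => ?_, fun hd => ?_, h4, h5, h6,
      fun A => ofReal_le_toENNReal ?_ (h7 A)⟩
    · rw [h3]
      exact hN'.trans (Nat.le_self_pow (by omega) _)
    · rw [h3, hd, pow_one, hN1 hd]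
    · rw [h3]
      by_cases hd : d = 1
      · subst hd
        have hN0 : (1 : ℝ) ≤ ((N' - 1 : ℕ) : ℝ) := by exact_mod_cast (by omega : 1 ≤ N' - 1)
        have hN3 : (N' : ℝ) = ((N' - 1 : ℕ) : ℝ) + 1 := by
          exact_mod_cast (by omega : N' = N' - 1 + 1)
        simp only [pow_one, one_mul, Nat.cast_one, Nat.cast_min]
        refine le_min ?_ ?_
        · linarith [min_le_right (1 - γ)⁻¹ (N' : ℝ)]
        · push_cast
          linarith [min_le_left (1 - γ)⁻¹ (N' : ℝ)]
      · have hN3 := hN2 hd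
        rw [min_eq_right (by omega : q + 1 ≤ N' - 1)]
        have hd0 : (0 : ℝ) ≤ d := Nat.cast_nonneg d
        have hmin := min_le_left ((d : ℝ) * (1 - γ)⁻¹) ((N' ^ d : ℕ) : ℝ)
        push_cast at hmin ⊢
        nlinarith [mul_le_mul_of_nonneg_left
          (by linarith : (1 - γ)⁻¹ ≤ 8 * ((q : ℝ) + 1)) hd0]
  · refine fun ε hε => ⟨1 / 50, by norm_num, fun d n m hn hnm => ?_⟩
    have hlt : n < m := by
      have : (0 : ℝ) < n := by exact_mod_cast (by omega : 0 < n)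
      exact_mod_cast (by nlinarith : (n : ℝ) < m)
    obtain ⟨X, G, H, h1, h2, h3, h4, h5⟩ := exists_class_with_degrees hn hlt d
    exact ⟨X, G, H, h1, h2, h3, h4, 1, one_pos, fun γ hγ _ A => h5 γ hγ A⟩
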